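/- **Conventions.** Words are finite sequences of positive integers. A word $\rho=(\rho_\ell,\dots,\rho_1)$ is *reduced* if the permutation $w=s_{\rho_\ell}\cdots s_{\rho_1}$, where $s_i$ exchanges $i$ and $i+1$, has exactly $\ell$ inversions (pairs $i<j$ with $w(i)>w(j)$). *Coxeter–Knuth equivalence* is the equivalence relation on reduced words generated by the following replacements of three consecutive letters: $a\,b\,a\leftrightarrow b\,a\,b$ if $|a-b|=1$; $b\,a\,c\leftrightarrow b\,c\,a$ and $a\,c\,b\leftrightarrow c\,a\,b$ if $a<b<c$. The *descent tableau* $\mathbb{D}(\rho)$ is the left-justified filling whose rows, from top to bottom, are the maximal strictly increasing runs of $\rho$, read from left to right. Row $1$ is the bottom row. A left-justified filling is *increasing* if its rows strictly increase from left to right and its columns strictly increase from bottom to top. It has *partition shape* if its row lengths weakly decrease from bottom to top; an *increasing Young tableau* is an increasing filling of partition shape. Rows may be empty. The *reading word* of a filling is obtained by reading its rows from left to right, starting with the top row. **Dropping two rows.** Let $\tau$ and $\sigma$ be strictly increasing words, possibly empty, with $\tau\sigma$ reduced. The *drop alignment* of $\sigma$ below $\tau$ is obtained by reading $\tau$ from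 left to right: each letter of $\tau$ is placed above the first letter of $\sigma$ not yet used if it is strictly larger than that letter; otherwise, or if $\sigma$ is used up, nothing is placed below it. Let $x_1,\dots,x_k$ be the letters of $\tau$ with nothing below them. Write $\tau=\tau^{(0)}x_1\tau^{(1)}\cdots x_k\tau^{(k)}$ and $\sigma=\sigma^{(0)}\sigma^{(1)}\cdots\sigma^{(k)}\sigma^{(k+1)}$, where $\sigma^{(j)}$ is the part of $\sigma$ below $\tau^{(j)}$ for $0\le j\le k$ and $\sigma^{(k+1)}$ is the unused part of $\sigma$. For $1\le j\le k$ let $\hat\sigma^{(j)}$ be obtained from $\sigma^{(j)}$ by adding $1$ to its first $b_j$ letters, where $b_j$ is the largest $b\le \ell(\sigma^{(j)})$ with $\sigma^{(j)}_i=\tau^{(j)}_1+i-2$ for all $1\le i\le b$ if $\tau^{(j)}$ is nonempty and $x_j=\tau^{(j)}_1-1$, and $b_j=0$ otherwise. The *drop* of the two rows replaces the upper row $\tau$ by $\tau^{(0)}\tau^{(1)}\cdots\tau^{(k)}$ and the lower row $\sigma$ by $\sigma^{(0)}x_1\hat\sigma^{(1)}\cdots x_k\hat\sigma^{(k)}\sigma^{(k+1)}$.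 **The drop of a word.** Let $\rho$ be a reduced word. Start with the filling $\mathbb{D}(\rho)$. Choose any $k$ such that row $k+1$ is longer than row $k$, or some entry of row $k+1$ is at most the entry directly below it in row $k$; replace rows $k+1$ and $k$ by their drop (this is $\mathrm{drop}_k$; emptied rows are kept). Repeat until the filling is an increasing Young tableau; $\mathrm{drop}(\rho)$ is its reading word. **Theorem.** Let $\rho$ be a reduced word. Then $\mathrm{drop}(\rho)$ is well defined: at every stage the rows are strictly increasing and the reading word is reduced, so the chosen $\mathrm{drop}_k$ is defined; the procedure terminates for every sequence of choices of $k$; an admissible $k$ is unavailable exactly when the filling is an increasing Young tableau; and the final tableau, hence $\mathrm{drop}(\rho)$, does not depend on the order in which the $\mathrm{drop}_k$ are applied. Moreover, $\mathrm{drop}(\rho)$ is the unique reduced word $\pi$ Coxeter–Knuth equivalent to $\rho$ such that $\mathbb{D}(\pi)$ is increasing and of partition shape. -/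

import Mathlib

/-! Words are lists of natural numbers, written from left to right.  Fillings of left-justified
diagrams are lists of rows, **listed from top to bottom**, so that `T.flatten` is the row reading
word (left to right along rows from the top) and the last row is row `1`. -/

namespace DropWord

/-! ### Reduced words -/

/-- The permutation `s_{ρ_ℓ} ⋯ s_{ρ_1}` of the word `ρ = (ρ_ℓ, …, ρ_1)`, where `s_i` interchanges
`i` and `i + 1`.  If all letters lie in `{1, …, n - 1}`, it fixes all points outside `{1, …, n}`,
so it is an element of the symmetric group `S_n`. -/
def wordPerm (ρ : List ℕ) : Equiv.Perm ℕ :=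
  (ρ.map fun i => Equiv.swap i (i + 1)).prod

/-- The length of a permutation: the number of pairs `i < j` with `w i > w j`. -/
noncomputable def permLength (w : Equiv.Perm ℕ) : ℕ :=
  {p : ℕ × ℕ | p.1 < p.2 ∧ w p.2 < w p.1}.ncard

/-- `ρ` is a reduced word (with positive letters): it has as many letters as its permutation has
inversions. -/
def IsReducedWord (ρ : List ℕ) : Prop :=
  (∀ i ∈ ρ, 1 ≤ i) ∧ permLength (wordPerm ρ) = ρ.length

/-! ### Coxeter–Knuth equivalence -/

/-- The action of an elementary Coxeter–Knuth relation `𝔡_i` on the three consecutive letters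
`(a, b, c) = (ρ_{i+1}, ρ_i, ρ_{i-1})`: a braid relation, the exchange of `b` and `c`, the exchange
of `a` and `b`, or nothing. -/
def ckTriple (a b c : ℕ) : List ℕ :=
  if a = c ∧ (a = b + 1 ∨ b = a + 1) then [b, a, b]
  else if (b < a ∧ a < c) ∨ (c < a ∧ a < b) then [a, c, b]
  else if (b < c ∧ c < a) ∨ (a < c ∧ c < b) then [b, a, c]
  else [a, b, c]

/-- `σ = 𝔡_i(ρ)` for some `i` (namely `i = v.length + 2`). -/
def CKStep (ρ σ : List ℕ) : Prop :=
  ∃ (u v : List ℕ) (a b c : ℕ), ρ = u ++ [a, b, c] ++ v ∧ σ = u ++ ckTriple a b c ++ v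

/-- Coxeter–Knuth equivalence: the equivalence relation generated by the `𝔡_i`.  Every `𝔡_i`
preserves the permutation and the length of a word, so the class of a reduced word consists of
reduced words. -/
def CKEquiv : List ℕ → List ℕ → Prop :=
  Relation.EqvGen CKStep

/-! ### Descent tableaux -/

/-- The descent tableau of a word: its rows, from top to bottom, are the maximal strictly
increasing runs of the word, from left to right. -/
def descentTableau (ρ : List ℕ) : List (List ℕ) :=
  ρ.splitBy fun a b => decide (a < b)

/-- All rows are strictly increasing, left to right. -/
def RowsIncreasing (T : List (List ℕ)) : Prop :=
  ∀ R ∈ T, R.Pairwise (· < ·)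

/-- All columns are strictly increasing, bottom to top. -/
def ColumnsIncreasing (T : List (List ℕ)) : Prop :=
  T.Pairwise fun U L => ∀ (j a b : ℕ), U[j]? = some a → L[j]? = some b → b < a

/-- A filling is increasing if its rows and its columns are. -/
def IsIncreasing (T : List (List ℕ)) : Prop :=
  RowsIncreasing T ∧ ColumnsIncreasing T

/-- The row lengths decrease weakly from the bottom row to the top row. (Empty rows may
occur, necessarily above all nonempty rows.) -/
def HasPartitionShape (T : List (List ℕ)) : Prop :=
  (T.map List.length).Pairwise (· ≤ ·)

/-! ### The drop of two rows -/

/-- The drop alignment of `σ` below `τ`, read from left to right. The value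
`(B₀, [(x₁, B₁), …, (x_k, B_k)], r)` means that `x₁, …, x_k` are the cells of `τ` with no cell
below them, `B_j` is the list of columns `(τ^{(j)}_i, σ^{(j)}_i)` of the `j`-th block, and
`r = σ^{(k+1)}` is the part of `σ` to the right of all of `τ`; so
`τ = τ^{(0)} x₁ τ^{(1)} ⋯ x_k τ^{(k)}` and `σ = σ^{(0)} σ^{(1)} ⋯ σ^{(k)} σ^{(k+1)}`.
A letter of `τ` stands above the next unused letter of `σ` if it is strictly larger; otherwise,
or if `σ` is used up, nothing is put below it. -/
def dropAlign : List ℕ → List ℕ → List (ℕ × ℕ) × List (ℕ × List (ℕ × ℕ)) × List ℕ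
  | [], σ => ([], [], σ)
  | t :: τ, [] =>
      let A := dropAlign τ []
      ([], (t, A.1) :: A.2.1, A.2.2)
  | t :: τ, s :: σ =>
      if s < t then
        let A := dropAlign τ σ
        ((t, s) :: A.1, A.2.1, A.2.2)
      else
        let A := dropAlign τ (s :: σ)
        ([], (t, A.1) :: A.2.1, A.2.2)

/-- Add one to the letters of the longest initial segment of the word that has the form
`x, x + 1, x + 2, …`. -/
def raiseRun : ℕ → List ℕ → List ℕ
  | _, [] => []
  | x, s :: σ => if s = x then (s + 1) :: raiseRun (x + 1) σ else s :: σ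

/-- The word `σ̂^{(j)}` for the block `B` with columns `(τ^{(j)}_i, σ^{(j)}_i)` after the
unsupported cell `x`: if `τ^{(j)}_1 = x + 1`, the letters `σ^{(j)}_1, …, σ^{(j)}_b` are raised by
one, where `b` is maximal with `σ^{(j)}_i = τ^{(j)}_1 + i - 2` for `1 ≤ i ≤ b`; otherwise nothing
changes. -/
def hatBlock (x : ℕ) (B : List (ℕ × ℕ)) : List ℕ :=
  if (B.map Prod.fst).head? = some (x + 1) then raiseRun x (B.map Prod.snd)
  else B.map Prod.snd

/-- The upper row `τ^{(0)} τ^{(1)} ⋯ τ^{(k)}` of the drop of `τ` above `σ`. -/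
def dropUpper (τ σ : List ℕ) : List ℕ :=
  let A := dropAlign τ σ
  A.1.map Prod.fst ++ A.2.1.flatMap fun B => B.2.map Prod.fst

/-- The lower row `σ^{(0)} x₁ σ̂^{(1)} ⋯ x_k σ̂^{(k)} σ^{(k+1)}` of the drop of `τ` above `σ`. -/
def dropLower (τ σ : List ℕ) : List ℕ :=
  let A := dropAlign τ σ
  A.1.map Prod.snd ++ (A.2.1.flatMap fun B => B.1 :: hatBlock B.1 B.2) ++ A.2.2

/-! ### The drop of a word -/

/-- Row `U` may be dropped onto the row `L` directly below it: `U` is longer than `L`, or some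
column is not strict. -/
def CanDrop (U L : List ℕ) : Prop :=
  L.length < U.length ∨ ∃ j a b : ℕ, U[j]? = some a ∧ L[j]? = some b ∧ a ≤ b

/-- One admissible application of some `drop_k` (namely `k = below.length + 1`): the rows `U`
(row `k + 1`) and `L` (row `k`) are replaced by the two rows of their drop. -/
def DropStep (T T' : List (List ℕ)) : Prop :=
  ∃ (above below : List (List ℕ)) (U L : List ℕ), CanDrop U L ∧
    T = above ++ U :: L :: below ∧ T' = above ++ dropUpper U L :: dropLower U L :: below

/-- `T` is obtained from the descent tableau of `ρ` by admissible applications of the `drop_k`,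
with arbitrary choices of `k`. -/
def Reaches (ρ : List ℕ) (T : List (List ℕ)) : Prop :=
  Relation.ReflTransGen DropStep (descentTableau ρ) T

/-- `π` is a value of `drop(ρ)`: the reading word of an increasing Young tableau at
which some sequence of admissible applications of the `drop_k` to the descent tableau of `ρ`
arrives. -/
def IsDrop (ρ π : List ℕ) : Prop :=
  ∃ T, Reaches ρ T ∧ IsIncreasing T ∧ HasPartitionShape T ∧ T.flatten = π

end DropWord

/-!
The proof identifies the drop of two rows with Edelman–Greene insertion. Inserting the letter `x`
into an increasing row replaces the first letter larger than `x` and bumps it; if `x` already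
occurs, the row is kept and `x + 1` is bumped (`rowIns`). By `wordIns_eq_drop`, the lower row of the
drop of `τ` above `σ` is the row obtained by inserting the letters of `σ` one after the other into
`τ`, and the upper row is the word of the bumped letters; the raised letters of the drop are the
letters `x + 1` that stay in the row when an equal `x` is inserted. This needs only one consequence
of reducedness: an increasing factor `t ⋯` followed by another `t` must go on with `t + 1`
(`IsReducedWord.exists_eq_succ_cons`).

Insertion of a letter is a chain of Coxeter–Knuth moves (`ckEquiv_rowIns`), so each step of the
procedure keeps the class of the reading word, hence its reducedness, and keeps the rows increasing.
A step moves at least one letter to a lower row, so the procedure terminates (`acc_dropStep`), and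
it stops when each row fits above the next one.

The result is unique since a class contains at most one increasing Young tableau
(`flatten_eq_of_ckEquiv`). Insertion into a row turns equivalent words into the same row and
equivalent bumped words (`SameIns.of_ckEquiv`); it suffices to check this for the three types of
elementary relations, by induction on the row, since letters larger than the first letter of the row
act on its tail only. On the other hand, inserting the reading word of an increasing Young tableau
into the empty row gives its bottom row and bumps the reading word of the other rows
(`wordIns_flatten`). So the class determines the tableau, row by row from the bottom.
-/

namespace DropWord

/-! ### Length and reduced words -/

theorem wordPerm_cons (i : ℕ) (ρ : List ℕ) :
    wordPerm (i :: ρ) = Equiv.swap i (i + 1) * wordPerm ρ := by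
  simp [wordPerm]

theorem wordPerm_append (u v : List ℕ) : wordPerm (u ++ v) = wordPerm u * wordPerm v := by
  simp [wordPerm]

/-- The inversions of a permutation, the set counted by `permLength`. -/
def inversions (w : Equiv.Perm ℕ) : Set (ℕ × ℕ) :=
  {p | p.1 < p.2 ∧ w p.2 < w p.1}

/-- An adjacent transposition changes the order of no pair but `(i, i + 1)`. -/
theorem lt_or_of_swap_lt {i p q : ℕ}
    (h : Equiv.swap i (i + 1) p < Equiv.swap i (i + 1) q) : p < q ∨ (p = i + 1 ∧ q = i) := by
  simp only [Equiv.swap_apply_def] at h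
  grind

/-- Left multiplication by `s_i` creates at most one inversion, at the positions of the values `i`
and `i + 1`. -/
theorem inversions_swap_mul (w : Equiv.Perm ℕ) (i : ℕ) :
    inversions (Equiv.swap i (i + 1) * w) ⊆
      insert (w.symm i, w.symm (i + 1)) (inversions w) := by
  rintro ⟨p, q⟩ ⟨hpq, h⟩
  rcases lt_or_of_swap_lt h with h | ⟨h, h'⟩
  · exact Or.inr ⟨hpq, h⟩
  · left
    simp only at h h'
    rw [← h, ← h']
    simp

/-- Right multiplication by `s_i` moves the positions of the inversions, and creates at most the
inversion `(i, i + 1)`. -/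
theorem inversions_mul_swap (w : Equiv.Perm ℕ) (i : ℕ) :
    inversions (w * Equiv.swap i (i + 1)) ⊆
      insert (i, i + 1)
        (Prod.map (Equiv.swap i (i + 1)) (Equiv.swap i (i + 1)) '' inversions w) := by
  rintro ⟨p, q⟩ ⟨hpq, h⟩
  simp only at hpq h
  have h' : Equiv.swap i (i + 1) (Equiv.swap i (i + 1) p) <
      Equiv.swap i (i + 1) (Equiv.swap i (i + 1) q) := by simpa using hpq
  rcases lt_or_of_swap_lt h' with h1 | ⟨h1, h2⟩
  · exact Or.inr ⟨(Equiv.swap i (i + 1) p, Equiv.swap i (i + 1) q), ⟨h1, h⟩, by simp⟩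
  · left
    rw [Equiv.swap_apply_eq_iff] at h1 h2
    simpa using And.intro h1 h2

theorem permLength_swap_mul {w : Equiv.Perm ℕ} (hw : (inversions w).Finite) (i : ℕ) :
    (inversions (Equiv.swap i (i + 1) * w)).Finite ∧
      permLength (Equiv.swap i (i + 1) * w) ≤ permLength w + 1 :=
  ⟨(hw.insert _).subset (inversions_swap_mul w i),
    (Set.ncard_le_ncard (inversions_swap_mul w i) (hw.insert _)).trans (Set.ncard_insert_le _ _)⟩

theorem permLength_mul_swap {w : Equiv.Perm ℕ} (hw : (inversions w).Finite) (i : ℕ) :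
    (inversions (w * Equiv.swap i (i + 1))).Finite ∧
      permLength (w * Equiv.swap i (i + 1)) ≤ permLength w + 1 :=
  ⟨((hw.image _).insert _).subset (inversions_mul_swap w i),
    (Set.ncard_le_ncard (inversions_mul_swap w i) ((hw.image _).insert _)).trans
      ((Set.ncard_insert_le _ _).trans (Nat.add_le_add_right (Set.ncard_image_le hw) 1))⟩

theorem permLength_wordPerm_mul {w : Equiv.Perm ℕ} (hw : (inversions w).Finite) (u : List ℕ) :
    (inversions (wordPerm u * w)).Finite ∧
      permLength (wordPerm u * w) ≤ u.length + permLength w := by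
  induction u with
  | nil => simpa [wordPerm] using hw
  | cons i u ih =>
    rw [wordPerm_cons, mul_assoc]
    obtain ⟨h1, h2⟩ := permLength_swap_mul ih.1 i
    refine ⟨h1, h2.trans ?_⟩
    simp only [List.length_cons]
    omega

theorem permLength_mul_wordPerm {w : Equiv.Perm ℕ} (hw : (inversions w).Finite) (u : List ℕ) :
    (inversions (w * wordPerm u)).Finite ∧
      permLength (w * wordPerm u) ≤ permLength w + u.length := by
  induction u generalizing w with
  | nil => simpa [wordPerm] using hw
  | cons i u ih =>
    rw [wordPerm_cons, ← mul_assoc]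
    obtain ⟨h1, h2⟩ := permLength_mul_swap hw i
    refine ⟨(ih h1).1, (ih h1).2.trans ?_⟩
    simp only [List.length_cons]
    omega

theorem permLength_wordPerm_le (ρ : List ℕ) :
    (inversions (wordPerm ρ)).Finite ∧ permLength (wordPerm ρ) ≤ ρ.length := by
  have he : inversions 1 = ∅ := by
    ext ⟨p, q⟩
    simp only [inversions, Equiv.Perm.coe_one, id_eq, Set.mem_ofPred_eq, Set.mem_empty_iff_false,
      iff_false]
    omega
  have hl : permLength 1 = 0 := by
    change (inversions 1).ncard = 0
    simp [he]
  simpa [hl] using permLength_wordPerm_mul (he ▸ Set.finite_empty : (inversions 1).Finite) ρ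

/-- A factor of a reduced word is reduced, since a letter changes the length of a permutation by at
most one, on either side. -/
theorem IsReducedWord.factor {u v w : List ℕ} (h : IsReducedWord (u ++ v ++ w)) :
    IsReducedWord v := by
  obtain ⟨hpos, hlen⟩ := h
  refine ⟨fun i hi => hpos i (by simp [hi]), ?_⟩
  obtain ⟨hf, hle⟩ := permLength_wordPerm_le v
  obtain ⟨hf', hle'⟩ := permLength_wordPerm_mul hf u
  obtain ⟨-, hle''⟩ := permLength_mul_wordPerm hf' w
  rw [wordPerm_append, wordPerm_append] at hlen
  simp only [List.length_append] at hlen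
  omega

theorem swap_mul_swap_comm {i j : ℕ} (h : i + 2 ≤ j) :
    Equiv.swap i (i + 1) * Equiv.swap j (j + 1) = Equiv.swap j (j + 1) * Equiv.swap i (i + 1) := by
  ext x
  simp only [Equiv.Perm.mul_apply, Equiv.swap_apply_def]
  grind

theorem swap_braid (i : ℕ) :
    Equiv.swap i (i + 1) * Equiv.swap (i + 1) (i + 1 + 1) * Equiv.swap i (i + 1) =
      Equiv.swap (i + 1) (i + 1 + 1) * Equiv.swap i (i + 1) *
        Equiv.swap (i + 1) (i + 1 + 1) := by
  ext x
  simp only [Equiv.Perm.mul_apply, Equiv.swap_apply_def]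
  grind

/-- In a reduced word, an increasing factor that starts with `t` and is followed by another `t`
continues with `t + 1`: otherwise the second `t` would commute back to the first one and cancel
it. -/
theorem IsReducedWord.exists_eq_succ_cons {t : ℕ} {R w : List ℕ}
    (hR : (t :: R).Pairwise (· < ·)) (h : IsReducedWord (t :: R ++ t :: w)) :
    ∃ R', R = (t + 1) :: R' := by
  rw [List.pairwise_cons] at hR
  by_contra hne
  have hbig : ∀ r ∈ R, t + 2 ≤ r := by
    cases R with
    | nil => simp
    | cons r R =>
      have h1 := hR.1 r (by simp)
      have h2 : r ≠ t + 1 := fun h => hne ⟨R, by rw [h]⟩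
      intro r' hr'
      have h3 := (List.pairwise_cons.1 hR.2).1
      rcases List.mem_cons.1 hr' with rfl | hr'
      · omega
      · have := h3 r' hr'
        omega
  have hcomm : ∀ R : List ℕ, (∀ r ∈ R, t + 2 ≤ r) →
      Equiv.swap t (t + 1) * wordPerm R = wordPerm R * Equiv.swap t (t + 1) := by
    intro R hR
    induction R with
    | nil => simp [wordPerm]
    | cons r R ih =>
      rw [wordPerm_cons, ← mul_assoc, swap_mul_swap_comm (hR r (by simp)), mul_assoc,
        ih fun r hr => hR r (by simp [hr]), mul_assoc]
  have hw : wordPerm (t :: R ++ t :: w) = wordPerm (R ++ w) := by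
    rw [wordPerm_append, wordPerm_cons, wordPerm_cons, hcomm R hbig, wordPerm_append]
    simp [mul_assoc]
  have h1 := h.2
  have h2 := (permLength_wordPerm_le (R ++ w)).2
  rw [hw] at h1
  simp only [List.length_append, List.length_cons] at h1 h2
  omega

/-! ### Coxeter–Knuth equivalence -/

theorem CKEquiv.refl (u : List ℕ) : CKEquiv u u := Relation.EqvGen.refl u

theorem CKEquiv.symm {u v : List ℕ} (h : CKEquiv u v) : CKEquiv v u := Relation.EqvGen.symm _ _ h

theorem CKEquiv.trans {u v w : List ℕ} (h : CKEquiv u v) (h' : CKEquiv v w) : CKEquiv u w :=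
  Relation.EqvGen.trans _ _ _ h h'

theorem CKEquiv.context {u v : List ℕ} (h : CKEquiv u v) (p q : List ℕ) :
    CKEquiv (p ++ u ++ q) (p ++ v ++ q) := by
  induction h with
  | rel u v h =>
    obtain ⟨u', v', a, b, c, rfl, rfl⟩ := h
    exact Relation.EqvGen.rel _ _ ⟨p ++ u', v' ++ q, a, b, c, by simp, by simp⟩
  | refl u => exact CKEquiv.refl _
  | symm u v _ ih => exact ih.symm
  | trans u v w _ _ ih ih' => exact ih.trans ih'

theorem ckEquiv_ckTriple (a b c : ℕ) : CKEquiv [a, b, c] (ckTriple a b c) :=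
  Relation.EqvGen.rel _ _ ⟨[], [], a, b, c, by simp, by simp⟩

theorem ckEquiv_bac {a b c : ℕ} (hab : a < b) (hbc : b < c) :
    CKEquiv [b, a, c] [b, c, a] := by
  have h : ckTriple b a c = [b, c, a] := by grind [ckTriple]
  exact h ▸ ckEquiv_ckTriple b a c

theorem ckEquiv_acb {a b c : ℕ} (hab : a < b) (hbc : b < c) :
    CKEquiv [a, c, b] [c, a, b] := by
  have h : ckTriple a c b = [c, a, b] := by grind [ckTriple]
  exact h ▸ ckEquiv_ckTriple a c b

theorem ckEquiv_braid (a : ℕ) : CKEquiv [a, a + 1, a] [a + 1, a, a + 1] := by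
  have h : ckTriple a (a + 1) a = [a + 1, a, a + 1] := by grind [ckTriple]
  exact h ▸ ckEquiv_ckTriple a (a + 1) a

/-- An elementary relation does nothing, or is one of the three basic replacements or the inverse of
one; the last of the alternatives is the inverse. -/
theorem ckTriple_cases {P : List ℕ → List ℕ → Prop}
    (bac : ∀ a b c, a < b → b < c → P [b, a, c] [b, c, a])
    (acb : ∀ a b c, a < b → b < c → P [a, c, b] [c, a, b])
    (braid : ∀ a, P [a, a + 1, a] [a + 1, a, a + 1]) (a b c : ℕ) :
    ckTriple a b c = [a, b, c] ∨ P [a, b, c] (ckTriple a b c) ∨ P (ckTriple a b c) [a, b, c] := by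
  unfold ckTriple
  split_ifs with h1 h2 h3
  · obtain ⟨rfl, rfl | rfl⟩ := h1
    · exact Or.inr (Or.inr (braid _))
    · exact Or.inr (Or.inl (braid _))
  · rcases h2 with ⟨h, h'⟩ | ⟨h, h'⟩
    · exact Or.inr (Or.inl (bac _ _ _ h h'))
    · exact Or.inr (Or.inr (bac _ _ _ h h'))
  · rcases h3 with ⟨h, h'⟩ | ⟨h, h'⟩
    · exact Or.inr (Or.inr (acb _ _ _ h h'))
    · exact Or.inr (Or.inl (acb _ _ _ h h'))
  · exact Or.inl rfl

theorem CKStep.isReducedWord_iff {u v : List ℕ} (h : CKStep u v) :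
    IsReducedWord u ↔ IsReducedWord v := by
  obtain ⟨p, q, a, b, c, rfl, rfl⟩ := h
  have key : wordPerm [a, b, c] = wordPerm (ckTriple a b c) ∧
      [a, b, c].length = (ckTriple a b c).length ∧
      ((∀ i ∈ [a, b, c], 1 ≤ i) ↔ ∀ i ∈ ckTriple a b c, 1 ≤ i) := by
    have hcases := ckTriple_cases (P := fun x y => wordPerm x = wordPerm y ∧
      x.length = y.length ∧ ((∀ i ∈ x, 1 ≤ i) ↔ ∀ i ∈ y, 1 ≤ i))
      (fun a b c hab hbc => ⟨by
        simp [wordPerm, swap_mul_swap_comm (show a + 2 ≤ c by omega)], rfl, by simp; tauto⟩)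
      (fun a b c hab hbc => ⟨by
        simp [wordPerm, ← mul_assoc, swap_mul_swap_comm (show a + 2 ≤ c by omega)], rfl, by
        simp; tauto⟩)
      (fun a => ⟨by simpa [wordPerm, ← mul_assoc] using swap_braid a, rfl, by simp⟩) a b c
    rcases hcases with h | h | h
    · simp [h]
    · exact h
    · exact ⟨h.1.symm, h.2.1.symm, h.2.2.symm⟩
  obtain ⟨h1, h2, h3⟩ := key
  unfold IsReducedWord
  simp only [wordPerm_append, h1, List.length_append, h2, List.forall_mem_append, h3]

theorem CKEquiv.isReducedWord_iff {u v : List ℕ} (h : CKEquiv u v) :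
    IsReducedWord u ↔ IsReducedWord v := by
  induction h with
  | rel u v h => exact h.isReducedWord_iff
  | refl u => exact Iff.rfl
  | symm u v _ ih => exact ih.symm
  | trans u v w _ _ ih ih' => exact ih.trans ih'

theorem CKEquiv.length_eq {u v : List ℕ} (h : CKEquiv u v) : u.length = v.length := by
  induction h with
  | rel u v h =>
    obtain ⟨p, q, a, b, c, rfl, rfl⟩ := h
    grind [ckTriple]
  | refl u => rfl
  | symm u v _ ih => exact ih.symm
  | trans u v w _ _ ih ih' => exact ih.trans ih'

/-! ### Row insertion -/

/-- Edelman–Greene insertion of the letter `x` into the increasing row: the new row, and the list of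
the at most one letter that is bumped. If `x` occurs in the row, the row is unchanged and `x + 1` is
bumped; when row and letter form a reduced word, `x + 1` then occurs in the row as well. -/
def rowIns (x : ℕ) : List ℕ → List ℕ × List ℕ
  | [] => ([x], [])
  | t :: R =>
      if x < t then (x :: R, [t])
      else if x = t then (t :: R, [t + 1])
      else (t :: (rowIns x R).1, (rowIns x R).2)

/-- Insertion of the letters of a word, from left to right, into a row: the final row, and the word
of the bumped letters in the order in which they are bumped. -/
def wordIns : List ℕ → List ℕ → List ℕ × List ℕ
  | R, [] => (R, [])
  | R, x :: w =>
      ((wordIns (rowIns x R).1 w).1, (rowIns x R).2 ++ (wordIns (rowIns x R).1 w).2)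

theorem rowIns_nil (x : ℕ) : rowIns x [] = ([x], []) := rfl

theorem rowIns_cons_of_lt {x t : ℕ} (h : x < t) (R : List ℕ) :
    rowIns x (t :: R) = (x :: R, [t]) := by
  simp [rowIns, h]

theorem rowIns_cons_self (t : ℕ) (R : List ℕ) : rowIns t (t :: R) = (t :: R, [t + 1]) := by
  simp [rowIns]

theorem rowIns_cons_of_gt {x t : ℕ} (h : t < x) (R : List ℕ) :
    rowIns x (t :: R) = (t :: (rowIns x R).1, (rowIns x R).2) := by
  simp [rowIns, h.not_gt, h.ne']

theorem lt_of_mem_rowIns_snd {x y : ℕ} {R : List ℕ} (h : y ∈ (rowIns x R).2) : x < y := by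
  induction R with
  | nil => simp [rowIns_nil] at h
  | cons t R ih =>
    rcases lt_trichotomy x t with hx | rfl | hx
    · simp_all [rowIns_cons_of_lt]
    · simp_all [rowIns_cons_self]
    · rw [rowIns_cons_of_gt hx] at h
      exact ih h

theorem bound_of_mem_rowIns_snd {t x y : ℕ} {R : List ℕ} (hR : ∀ r ∈ R, t < r)
    (h : y ∈ (rowIns x R).2) : t < y := by
  induction R with
  | nil => simp [rowIns_nil] at h
  | cons r R ih =>
    have hr := hR r (by simp)
    rcases lt_trichotomy x r with hx | rfl | hx
    · simp_all [rowIns_cons_of_lt]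
    · rw [rowIns_cons_self] at h
      simp at h
      omega
    · rw [rowIns_cons_of_gt hx] at h
      exact ih (fun r hr => hR r (by simp [hr])) h

theorem bound_of_mem_rowIns_fst {t x : ℕ} {R : List ℕ} (hR : ∀ r ∈ R, t < r) (hx : t < x) :
    ∀ r ∈ (rowIns x R).1, t < r := by
  induction R with
  | nil => simpa [rowIns_nil] using hx
  | cons r R ih =>
    have hR' := fun r hr => hR r (List.mem_cons_of_mem _ hr)
    rcases lt_trichotomy x r with hx | rfl | hx
    · rw [rowIns_cons_of_lt hx]
      simpa using ⟨‹_›, hR'⟩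
    · rw [rowIns_cons_self]
      exact hR
    · rw [rowIns_cons_of_gt hx]
      simpa using ⟨hR r (by simp), ih hR'⟩

theorem pairwise_rowIns {R : List ℕ} (hR : R.Pairwise (· < ·)) (x : ℕ) :
    (rowIns x R).1.Pairwise (· < ·) := by
  induction R with
  | nil => simp [rowIns_nil]
  | cons t R ih =>
    rw [List.pairwise_cons] at hR
    rcases lt_trichotomy x t with hx | rfl | hx
    · rw [rowIns_cons_of_lt hx]
      exact List.pairwise_cons.2 ⟨fun r hr => hx.trans (hR.1 r hr), hR.2⟩
    · rw [rowIns_cons_self]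
      exact List.pairwise_cons.2 hR
    · rw [rowIns_cons_of_gt hx]
      exact List.pairwise_cons.2 ⟨bound_of_mem_rowIns_fst hR.1 hx, ih hR.2⟩

theorem pairwise_wordIns {R : List ℕ} (hR : R.Pairwise (· < ·)) (w : List ℕ) :
    (wordIns R w).1.Pairwise (· < ·) := by
  induction w generalizing R with
  | nil => exact hR
  | cons x w ih => exact ih (pairwise_rowIns hR x)

theorem rowIns_snd_eq (x : ℕ) (R : List ℕ) :
    (rowIns x R).2 = [] ∨ ∃ y, (rowIns x R).2 = [y] := by
  induction R with
  | nil => exact Or.inl rfl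
  | cons t R ih =>
    unfold rowIns
    split_ifs
    · exact Or.inr ⟨_, rfl⟩
    · exact Or.inr ⟨_, rfl⟩
    · exact ih

/-- Letters inserted in increasing order bump letters in increasing order; once a letter is
appended, so are the larger ones after it. -/
theorem rowIns_snd_of_lt {R : List ℕ} (hR : R.Pairwise (· < ·)) {b c : ℕ} (hbc : b < c) :
    ((rowIns b R).2 = [] → (rowIns c (rowIns b R).1).2 = []) ∧
      ∀ y ∈ (rowIns b R).2, ∀ z ∈ (rowIns c (rowIns b R).1).2, y < z := by
  induction R with
  | nil => simp [rowIns_nil, rowIns_cons_of_gt hbc]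
  | cons t R ih =>
    rw [List.pairwise_cons] at hR
    rcases lt_trichotomy b t with hb | rfl | hb
    · rw [rowIns_cons_of_lt hb]
      simp only [rowIns_cons_of_gt hbc]
      exact ⟨by simp, by simpa using fun z hz => bound_of_mem_rowIns_snd hR.1 hz⟩
    · rw [rowIns_cons_self]
      refine ⟨by simp, ?_⟩
      intro y hy z hz
      have := lt_of_mem_rowIns_snd hz
      simp at hy
      omega
    · rw [rowIns_cons_of_gt hb]
      simp only [rowIns_cons_of_gt (hb.trans hbc)]
      exact ih hR.2

/-- A letter inserted after a larger one `c` bumps a letter, and that letter is at most `c`. -/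
theorem rowIns_snd_of_gt (R : List ℕ) {b c : ℕ} (hbc : b < c) :
    ∃ z ≤ c, (rowIns b (rowIns c R).1).2 = [z] := by
  induction R with
  | nil => exact ⟨c, le_rfl, by simp [rowIns_nil, rowIns_cons_of_lt hbc]⟩
  | cons t R ih =>
    rcases lt_trichotomy c t with hc | rfl | hc
    · exact ⟨c, le_rfl, by simp [rowIns_cons_of_lt, hc, hbc]⟩
    · exact ⟨c, le_rfl, by simp [rowIns_cons_self, rowIns_cons_of_lt hbc]⟩
    · rw [rowIns_cons_of_gt hc]
      rcases lt_trichotomy b t with hb | rfl | hb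
      · exact ⟨t, hc.le, by simp [rowIns_cons_of_lt hb]⟩
      · exact ⟨b + 1, hc, by simp [rowIns_cons_self]⟩
      · simpa only [rowIns_cons_of_gt hb] using ih

/-- A letter smaller than an increasing row moves to the left through the row but for its first
letter. -/
theorem ckEquiv_move_left {x t : ℕ} {R : List ℕ} (hR : (t :: R).Pairwise (· < ·)) (hx : x < t) :
    CKEquiv (t :: R ++ [x]) (t :: x :: R) := by
  induction R generalizing t with
  | nil => exact CKEquiv.refl _
  | cons r R ih =>
    obtain ⟨h1, h2⟩ := List.pairwise_cons.1 hR
    have htr := h1 r (by simp)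
    have e1 : CKEquiv (t :: r :: R ++ [x]) (t :: r :: x :: R) := by
      simpa using (ih h2 (hx.trans htr)).context [t] []
    have e2 : CKEquiv (t :: r :: x :: R) (t :: x :: r :: R) := by
      simpa using (ckEquiv_bac hx htr).symm.context [] R
    exact e1.trans e2

/-- Row insertion is a Coxeter–Knuth equivalence: a row followed by the letter is equivalent to the
bumped letter followed by the new row. -/
theorem ckEquiv_rowIns {x : ℕ} {R : List ℕ} (hR : R.Pairwise (· < ·))
    (h : IsReducedWord (R ++ [x])) :
    CKEquiv (R ++ [x]) ((rowIns x R).2 ++ (rowIns x R).1) := by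
  induction R with
  | nil => exact CKEquiv.refl _
  | cons t R ih =>
    rcases lt_trichotomy x t with hx | rfl | hx
    · rw [rowIns_cons_of_lt hx]
      exact ckEquiv_move_left hR hx
    · rw [rowIns_cons_self]
      obtain ⟨R, rfl⟩ := h.exists_eq_succ_cons hR
      have e1 : CKEquiv (x :: (x + 1) :: R ++ [x]) (x :: (x + 1) :: x :: R) := by
        simpa using
          (ckEquiv_move_left (List.pairwise_cons.1 hR).2 (Nat.lt_succ_self x)).context [x] []
      exact e1.trans (by simpa using (ckEquiv_braid x).context [] R)
    · have h' : IsReducedWord (R ++ [x]) :=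
        IsReducedWord.factor (u := [t]) (w := []) (by simpa using h)
      rw [List.pairwise_cons] at hR
      have e1 : CKEquiv (t :: R ++ [x]) (t :: ((rowIns x R).2 ++ (rowIns x R).1)) := by
        simpa using (ih hR.2 h').context [t] []
      rw [rowIns_cons_of_gt hx]
      refine e1.trans ?_
      rcases rowIns_snd_eq x R with h0 | ⟨y, hy⟩
      · rw [h0]
        exact CKEquiv.refl _
      · have hxy : x < y := lt_of_mem_rowIns_snd (R := R) (by simp [hy])
        obtain ⟨r, R', hr, hrx⟩ : ∃ r R', (rowIns x R).1 = r :: R' ∧ r ≤ x := by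
          cases R with
          | nil => exact ⟨x, [], rfl, le_rfl⟩
          | cons r R =>
            rcases lt_trichotomy x r with hx | rfl | hx
            · exact ⟨x, R, by rw [rowIns_cons_of_lt hx], le_rfl⟩
            · exact ⟨x, R, by rw [rowIns_cons_self], le_rfl⟩
            · exact ⟨r, _, by rw [rowIns_cons_of_gt hx], hx.le⟩
        have htr : t < r := bound_of_mem_rowIns_fst hR.1 hx r (by simp [hr])
        rw [hy, hr]
        simpa using (ckEquiv_acb htr (hrx.trans_lt hxy)).context [] R'

theorem ckEquiv_wordIns {R w : List ℕ} (hR : R.Pairwise (· < ·)) (h : IsReducedWord (R ++ w)) :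
    CKEquiv (R ++ w) ((wordIns R w).2 ++ (wordIns R w).1) := by
  induction w generalizing R with
  | nil => simpa [wordIns] using CKEquiv.refl R
  | cons x w ih =>
    have hx : IsReducedWord (R ++ [x]) :=
      IsReducedWord.factor (u := []) (w := w) (by simpa using h)
    have e1 : CKEquiv (R ++ x :: w) ((rowIns x R).2 ++ ((rowIns x R).1 ++ w)) := by
      simpa using (ckEquiv_rowIns hR hx).context [] w
    have h' : IsReducedWord ((rowIns x R).1 ++ w) :=
      IsReducedWord.factor (u := (rowIns x R).2) (w := []) (by
        simpa using e1.isReducedWord_iff.1 h)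
    refine e1.trans ?_
    simpa [wordIns] using (ih (pairwise_rowIns hR x) h').context (rowIns x R).2 []

theorem wordIns_append (R u v : List ℕ) :
    wordIns R (u ++ v) =
      ((wordIns (wordIns R u).1 v).1, (wordIns R u).2 ++ (wordIns (wordIns R u).1 v).2) := by
  induction u generalizing R with
  | nil => simp [wordIns]
  | cons x u ih => simp [wordIns, ih]

theorem wordIns_cons_of_lt {t : ℕ} {w : List ℕ} (hw : ∀ x ∈ w, t < x) (R : List ℕ) :
    wordIns (t :: R) w = (t :: (wordIns R w).1, (wordIns R w).2) := by
  induction w generalizing R with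
  | nil => rfl
  | cons x w ih =>
    simp only [wordIns, rowIns_cons_of_gt (hw x (by simp)),
      ih fun x hx => hw x (by simp [hx])]

/-! ### Insertion of Coxeter–Knuth equivalent words -/

/-- Insertion of the words `u` and `v` into `R` gives the same row and equivalent bumped words. -/
def SameIns (R u v : List ℕ) : Prop :=
  (wordIns R u).1 = (wordIns R v).1 ∧ CKEquiv (wordIns R u).2 (wordIns R v).2

theorem SameIns.symm {R u v : List ℕ} (h : SameIns R u v) : SameIns R v u :=
  ⟨h.1.symm, h.2.symm⟩

theorem SameIns.cons {t : ℕ} {R u v : List ℕ} (h : SameIns R u v) (hu : ∀ x ∈ u, t < x)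
    (hv : ∀ x ∈ v, t < x) : SameIns (t :: R) u v := by
  unfold SameIns
  rw [wordIns_cons_of_lt hu, wordIns_cons_of_lt hv]
  exact ⟨by simpa using h.1, h.2⟩

/-- If `t < a`, all three letters pass the first cell. Otherwise `a` acts on the first cell only,
and the bumped words are equal or related by the same type of replacement. -/
theorem sameIns_bac {a b c : ℕ} (hab : a < b) (hbc : b < c) {R : List ℕ}
    (hR : R.Pairwise (· < ·)) : SameIns R [b, a, c] [b, c, a] := by
  have hac := hab.trans hbc
  induction R with
  | nil =>
    simp [SameIns, wordIns, rowIns_nil, rowIns_cons_of_lt, rowIns_cons_of_gt, hab, hbc, hac,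
      CKEquiv.refl]
  | cons t R ih =>
    rcases lt_or_ge t a with ha | ha
    · exact (ih hR.of_cons).cons (by simp; omega) (by simp; omega)
    have ht := (List.pairwise_cons.1 hR).1
    rcases lt_trichotomy b t with hb | rfl | hb
    · have hat := hab.trans hb
      refine ⟨by simp [wordIns, rowIns_cons_of_lt, rowIns_cons_of_gt, *], ?_⟩
      simp only [wordIns, rowIns_cons_of_lt, rowIns_cons_of_gt, *]
      rcases rowIns_snd_eq c R with ho | ⟨o, ho⟩
      · simpa [ho] using CKEquiv.refl _
      · have : t < o := bound_of_mem_rowIns_snd (x := c) ht (by simp [ho])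
        simpa [ho] using ckEquiv_bac hb this
    · refine ⟨by simp [wordIns, rowIns_cons_of_lt, rowIns_cons_of_gt, rowIns_cons_self, *], ?_⟩
      simp only [wordIns, rowIns_cons_of_lt, rowIns_cons_of_gt, rowIns_cons_self, *]
      rcases rowIns_snd_eq c R with ho | ⟨o, ho⟩
      · simpa [ho] using CKEquiv.refl _
      · have : c < o := lt_of_mem_rowIns_snd (R := R) (by simp [ho])
        simpa [ho] using ckEquiv_bac (Nat.lt_succ_self b) (show b + 1 < o by omega)
    · have hct := hb.trans hbc
      have hinc := rowIns_snd_of_lt hR.of_cons hbc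
      -- Inserting `a` acts on the first cell only: it bumps `y` and leaves the letter `t'` there.
      obtain ⟨y, t', hy, hya⟩ : ∃ y t', (∀ R, rowIns a (t :: R) = (t' :: R, [y])) ∧
          (y = t ∨ y = a + 1) ∧ t' ≤ a := by
        rcases ha.lt_or_eq with ha | rfl
        · exact ⟨t, a, fun R => rowIns_cons_of_lt ha R, Or.inl rfl, le_rfl⟩
        · exact ⟨a + 1, a, fun R => rowIns_cons_self a R, Or.inr rfl, le_rfl⟩
      have hct' : t' < c := by omega
      refine ⟨by simp [wordIns, rowIns_cons_of_gt, *], ?_⟩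
      simp only [wordIns, rowIns_cons_of_gt, *]
      rcases rowIns_snd_eq b R with ho | ⟨o, ho⟩
      · simpa [ho, hinc.1 ho] using CKEquiv.refl _
      · rcases rowIns_snd_eq c (rowIns b R).1 with ho' | ⟨o', ho'⟩
        · simpa [ho, ho'] using CKEquiv.refl _
        · have h1 : b < o := lt_of_mem_rowIns_snd (R := R) (by simp [ho])
          have h2 : o < o' := hinc.2 o (by simp [ho]) o' (by simp [ho'])
          simpa [ho, ho'] using ckEquiv_bac (show y < o by omega) h2

/-- As for `sameIns_bac`, but the type may change: if `c` is smaller than the first letter `t` of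
the row, the bumped words are equal or related as in `ckEquiv_bac`, and if `c = t`, when reducedness
makes `t + 1` the second letter of the row, by a braid relation. -/
theorem sameIns_acb {a b c : ℕ} (hab : a < b) (hbc : b < c) {R : List ℕ}
    (hR : R.Pairwise (· < ·)) (hred : IsReducedWord (R ++ [c, a, b])) :
    SameIns R [a, c, b] [c, a, b] := by
  have hac := hab.trans hbc
  induction R with
  | nil =>
    simp [SameIns, wordIns, rowIns_nil, rowIns_cons_of_lt, rowIns_cons_of_gt, hab, hbc, hac,
      CKEquiv.refl]
  | cons t R ih =>
    rcases lt_or_ge t a with ha | ha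
    · refine (ih hR.of_cons ?_).cons (by simp; omega) (by simp; omega)
      exact IsReducedWord.factor (u := [t]) (w := []) (by simpa using hred)
    have ht := (List.pairwise_cons.1 hR).1
    rcases lt_trichotomy c t with hc | rfl | hc
    · have hat := hac.trans hc
      cases R with
      | nil =>
        simp [SameIns, wordIns, rowIns_nil, rowIns_cons_of_lt, rowIns_cons_of_gt, *,
          CKEquiv.refl]
      | cons r R =>
        have hr := ht r (by simp)
        have hcr := hc.trans hr
        have hbr := hbc.trans hcr
        refine ⟨by simp [wordIns, rowIns_cons_of_lt, rowIns_cons_of_gt, *], ?_⟩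
        simpa [wordIns, rowIns_cons_of_lt, rowIns_cons_of_gt, *] using
          (ckEquiv_bac hc hr).symm
    · obtain ⟨R, rfl⟩ := hred.exists_eq_succ_cons hR
      have h1 : b < c + 1 := by omega
      refine ⟨by simp [wordIns, rowIns_cons_of_lt, rowIns_cons_of_gt, rowIns_cons_self, *], ?_⟩
      simpa [wordIns, rowIns_cons_of_lt, rowIns_cons_of_gt, rowIns_cons_self, *] using
        ckEquiv_braid c
    · -- Inserting `a` acts on the first cell only: it bumps `y` and leaves the letter `t'` there.
      obtain ⟨y, t', hy, hya⟩ : ∃ y t', (∀ R, rowIns a (t :: R) = (t' :: R, [y])) ∧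
          (y = t ∨ y = a + 1) ∧ t' ≤ a ∧ a ≤ t := by
        rcases ha.lt_or_eq with ha | rfl
        · exact ⟨t, a, fun R => rowIns_cons_of_lt ha R, Or.inl rfl, le_rfl, ha.le⟩
        · exact ⟨a + 1, a, fun R => rowIns_cons_self a R, Or.inr rfl, le_rfl, le_rfl⟩
      have hct' : t' < c := by omega
      have hbt' : t' < b := by omega
      refine ⟨by simp [wordIns, rowIns_cons_of_gt, *], ?_⟩
      simp only [wordIns, rowIns_cons_of_gt, *]
      obtain ⟨o', hle, ho'⟩ := rowIns_snd_of_gt R hbc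
      rcases rowIns_snd_eq c R with ho | ⟨o, ho⟩
      · simpa [ho, ho'] using CKEquiv.refl _
      · have h1 : c < o := lt_of_mem_rowIns_snd (R := R) (by simp [ho])
        have h2 : b < o' := lt_of_mem_rowIns_snd (R := (rowIns c R).1) (by simp [ho'])
        have h3 : t < o' := bound_of_mem_rowIns_snd (x := b)
          (bound_of_mem_rowIns_fst ht hc) (by simp [ho'])
        simpa [ho, ho'] using ckEquiv_acb (show y < o' by omega) (show o' < o by omega)

/-- The bumped words are related by a braid relation; but if both letters are smaller than the row,
they are equal or related as in `ckEquiv_bac`. -/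
theorem sameIns_braid {a : ℕ} {R : List ℕ} (hR : R.Pairwise (· < ·))
    (hred : IsReducedWord (R ++ [a, a + 1, a])) (hred' : IsReducedWord (R ++ [a + 1, a, a + 1])) :
    SameIns R [a, a + 1, a] [a + 1, a, a + 1] := by
  induction R with
  | nil => simp [SameIns, wordIns, rowIns, CKEquiv.refl]
  | cons t R ih =>
    have ht := (List.pairwise_cons.1 hR).1
    rcases lt_trichotomy a t with ha | rfl | ha
    · rcases Nat.lt_or_ge (a + 1) t with ha' | ha'
      · cases R with
        | nil =>
          simp [SameIns, wordIns, rowIns_nil, rowIns_cons_of_lt, rowIns_cons_of_gt,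
            rowIns_cons_self, *, CKEquiv.refl]
        | cons r R =>
          have hr := ht r (by simp)
          have har := ha'.trans hr
          refine ⟨by simp [wordIns, rowIns_cons_of_lt, rowIns_cons_of_gt, rowIns_cons_self, *], ?_⟩
          simpa [wordIns, rowIns_cons_of_lt, rowIns_cons_of_gt, rowIns_cons_self, *] using
            (ckEquiv_bac ha' hr).symm
      · obtain rfl : t = a + 1 := by omega
        obtain ⟨R, rfl⟩ := hred'.exists_eq_succ_cons hR
        refine ⟨by simp [wordIns, rowIns_cons_of_lt, rowIns_cons_of_gt, rowIns_cons_self], ?_⟩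
        simpa [wordIns, rowIns_cons_of_lt, rowIns_cons_of_gt, rowIns_cons_self] using
          ckEquiv_braid (a + 1)
    · obtain ⟨R, rfl⟩ := hred.exists_eq_succ_cons hR
      refine ⟨by simp [wordIns, rowIns_cons_of_gt, rowIns_cons_self], ?_⟩
      simpa [wordIns, rowIns_cons_of_gt, rowIns_cons_self] using ckEquiv_braid (a + 1)
    · refine (ih hR.of_cons ?_ ?_).cons (by simp; omega) (by simp; omega)
      · exact IsReducedWord.factor (u := [t]) (w := []) (by simpa using hred)
      · exact IsReducedWord.factor (u := [t]) (w := []) (by simpa using hred')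

/-- Letters before the replaced triple only change the row into which it is inserted, and the
letters after it see equal rows. -/
theorem SameIns.of_ckStep {R u v : List ℕ} (hR : R.Pairwise (· < ·))
    (hred : IsReducedWord (R ++ u)) (h : CKStep u v) : SameIns R u v := by
  obtain ⟨p, q, a, b, c, rfl, rfl⟩ := h
  set R' := (wordIns R p).1 with hR'
  have hR's : R'.Pairwise (· < ·) := pairwise_wordIns hR p
  have hp : IsReducedWord (R ++ p) :=
    IsReducedWord.factor (u := []) (w := [a, b, c] ++ q) (by simpa using hred)
  have hred' : IsReducedWord (R' ++ [a, b, c]) := by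
    refine IsReducedWord.factor (u := (wordIns R p).2) (w := q) ?_
    have := (ckEquiv_wordIns hR hp).context [] ([a, b, c] ++ q)
    simpa using this.isReducedWord_iff.1 (by simpa using hred)
  have hred'' : IsReducedWord (R' ++ ckTriple a b c) := by
    have := (ckEquiv_ckTriple a b c).context R' []
    simpa using this.isReducedWord_iff.1 (by simpa using hred')
  have key : SameIns R' [a, b, c] (ckTriple a b c) := by
    rcases ckTriple_cases (P := fun x y => IsReducedWord (R' ++ x) → IsReducedWord (R' ++ y) →
        SameIns R' x y) (fun a b c hab hbc _ _ => sameIns_bac hab hbc hR's)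
        (fun a b c hab hbc _ h => sameIns_acb hab hbc hR's h)
        (fun a h h' => sameIns_braid hR's h h') a b c with h | h | h
    · rw [h]
      exact ⟨rfl, CKEquiv.refl _⟩
    · exact h hred' hred''
    · exact (h hred'' hred').symm
  obtain ⟨h1, h2⟩ := key
  refine ⟨by simp only [wordIns_append, ← hR', h1], ?_⟩
  simp only [wordIns_append, ← hR', h1]
  exact h2.context _ _

/-- Insertion of equivalent words into a row gives the same row and equivalent bumped words. -/
theorem SameIns.of_ckEquiv {R u v : List ℕ} (hR : R.Pairwise (· < ·))
    (h : CKEquiv u v) (hred : IsReducedWord (R ++ u)) : SameIns R u v := by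
  induction h with
  | rel u v h => exact SameIns.of_ckStep hR hred h
  | refl u => exact ⟨rfl, CKEquiv.refl _⟩
  | symm u v h ih =>
    have h' := CKEquiv.context h R []
    exact (ih (by simpa using h'.isReducedWord_iff.2 (by simpa using hred))).symm
  | trans u v w h _ ih ih' =>
    have h' := CKEquiv.context h R []
    have h1 := ih hred
    have h2 := ih' (by simpa using h'.isReducedWord_iff.1 (by simpa using hred))
    exact ⟨h1.1.trans h2.1, h1.2.trans h2.2⟩

/-! ### The drop of two rows as insertion -/

theorem dropUpper_nil_left (σ : List ℕ) : dropUpper [] σ = [] := rfl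

theorem dropLower_nil_left (σ : List ℕ) : dropLower [] σ = σ := rfl

theorem dropUpper_cons_of_lt {s t : ℕ} (h : s < t) (τ σ : List ℕ) :
    dropUpper (t :: τ) (s :: σ) = t :: dropUpper τ σ := by
  simp [dropUpper, dropAlign, h]

theorem dropLower_cons_of_lt {s t : ℕ} (h : s < t) (τ σ : List ℕ) :
    dropLower (t :: τ) (s :: σ) = s :: dropLower τ σ := by
  simp [dropLower, dropAlign, h]

theorem dropUpper_cons_of_ge {s t : ℕ} (h : t ≤ s) (τ σ : List ℕ) :
    dropUpper (t :: τ) (s :: σ) = dropUpper τ (s :: σ) := by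
  simp [dropUpper, dropAlign, h.not_gt]

theorem dropAlign_nil_right (τ : List ℕ) :
    dropAlign τ [] = ([], τ.map fun t => (t, []), []) := by
  induction τ with
  | nil => rfl
  | cons t τ ih => simp [dropAlign, ih]

theorem dropUpper_nil_right (τ : List ℕ) : dropUpper τ [] = [] := by
  simp [dropUpper, dropAlign_nil_right]

theorem dropLower_nil_right (τ : List ℕ) : dropLower τ [] = τ := by
  simp [dropLower, dropAlign_nil_right, hatBlock, List.flatMap_map]

/-- If `t < s`, the block after the unsupported letter `t` cannot start with `t + 1`, which is not
larger than `s`; so nothing is raised. -/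
theorem dropLower_cons_of_gt {s t : ℕ} (h : t < s) (τ σ : List ℕ) :
    dropLower (t :: τ) (s :: σ) = t :: dropLower τ (s :: σ) := by
  have hhat : hatBlock t (dropAlign τ (s :: σ)).1 = (dropAlign τ (s :: σ)).1.map Prod.snd := by
    unfold hatBlock
    split_ifs with hh
    · cases τ with
      | nil => simp [dropAlign] at hh
      | cons t' τ =>
        by_cases hs : s < t'
        · simp [dropAlign, hs] at hh
          omega
        · simp [dropAlign, hs] at hh
    · rfl
  simp [dropLower, dropAlign, h.not_gt, hhat]

/-- The condition on the first upper letter in `hatBlock` is automatic if `τ` goes on with `t + 1`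
whenever `σ` starts with `t`. -/
theorem raiseRun_map_snd_eq_hatBlock {t : ℕ} {τ σ : List ℕ}
    (h : ∀ σ', σ = t :: σ' → ∃ τ', τ = (t + 1) :: τ') :
    raiseRun t ((dropAlign τ σ).1.map Prod.snd) = hatBlock t (dropAlign τ σ).1 := by
  unfold hatBlock
  split_ifs with hh
  · rfl
  · cases τ with
    | nil => rfl
    | cons t' τ =>
      cases σ with
      | nil => simp [dropAlign, raiseRun]
      | cons s σ =>
        by_cases hs : s < t'
        · have : s ≠ t := by
            rintro rfl
            obtain ⟨τ', hτ'⟩ := h σ rfl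
            simp_all [dropAlign]
          simp [dropAlign, hs, raiseRun, this]
        · simp [dropAlign, hs, raiseRun]

/-- The case of equal first letters. The letter `t` of `τ` is unsupported, and `t + 1` stands above
the `t` of `σ`, which is raised to `t + 1`; the raising continues exactly as if `t + 1` were an
unsupported letter of the shorter row. -/
theorem dropLower_cons_self {t : ℕ} {τ σ : List ℕ} (hσ : ∀ s ∈ σ, t < s)
    (h : ∀ σ', σ = (t + 1) :: σ' → ∃ τ', τ = (t + 2) :: τ') :
    dropLower (t :: (t + 1) :: τ) (t :: σ) = t :: dropLower ((t + 1) :: τ) σ := by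
  have hhat := raiseRun_map_snd_eq_hatBlock (t := t + 1) h
  have e : dropLower ((t + 1) :: τ) σ = (t + 1) :: (hatBlock (t + 1) (dropAlign τ σ).1 ++
      ((dropAlign τ σ).2.1.flatMap fun B => B.1 :: hatBlock B.1 B.2) ++ (dropAlign τ σ).2.2) := by
    cases σ with
    | nil => simp [dropLower, dropAlign]
    | cons s σ =>
      have : ¬ s < t + 1 := by simpa using Nat.succ_le_of_lt (hσ s (by simp))
      simp [dropLower, dropAlign, this]
  rw [e, ← hhat]
  simp [dropLower, dropAlign, hatBlock, raiseRun]

/-- The drop of `τ` above `σ` is the Edelman–Greene insertion of the letters of `σ`, from left to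
right, into the row `τ`. -/
theorem wordIns_eq_drop {τ σ : List ℕ} (hτ : τ.Pairwise (· < ·)) (hσ : σ.Pairwise (· < ·))
    (h : IsReducedWord (τ ++ σ)) : wordIns τ σ = (dropLower τ σ, dropUpper τ σ) := by
  induction τ generalizing σ with
  | nil =>
    rw [dropLower_nil_left, dropUpper_nil_left]
    clear h
    induction σ with
    | nil => rfl
    | cons s σ ih =>
      rw [List.pairwise_cons] at hσ
      simp [wordIns, rowIns_nil, wordIns_cons_of_lt hσ.1, ih hσ.2]
  | cons t τ ih =>
    cases σ with
    | nil => simp [wordIns, dropLower_nil_right, dropUpper_nil_right]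
    | cons s σ =>
      obtain ⟨hs, hσ'⟩ := List.pairwise_cons.1 hσ
      have hins : IsReducedWord ((rowIns s (t :: τ)).2 ++ (rowIns s (t :: τ)).1 ++ σ) := by
        have h1 : IsReducedWord (t :: τ ++ [s]) :=
          IsReducedWord.factor (u := []) (w := σ) (by simpa using h)
        have := (ckEquiv_rowIns hτ h1).context [] σ
        simpa using this.isReducedWord_iff.1 (by simpa using h)
      rcases lt_trichotomy s t with hst | rfl | hst
      · rw [rowIns_cons_of_lt hst] at hins
        have hred : IsReducedWord (τ ++ σ) :=
          IsReducedWord.factor (u := [t, s]) (w := []) (by simpa using hins)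
        rw [dropLower_cons_of_lt hst, dropUpper_cons_of_lt hst]
        simp [wordIns, rowIns_cons_of_lt hst, wordIns_cons_of_lt hs, ih hτ.of_cons hσ' hred]
      · obtain ⟨τ, rfl⟩ := h.exists_eq_succ_cons hτ
        rw [rowIns_cons_self] at hins
        have hred : IsReducedWord ((s + 1) :: τ ++ σ) :=
          IsReducedWord.factor (u := [s + 1, s]) (w := []) (by simpa using hins)
        have hup : dropUpper ((s + 1) :: τ) σ = dropUpper τ σ := by
          cases σ with
          | nil => simp [dropUpper_nil_right]
          | cons s' σ => exact dropUpper_cons_of_ge (hs s' (by simp)) τ σ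
        have hsucc : ∀ σ', σ = (s + 1) :: σ' → ∃ τ', τ = (s + 2) :: τ' := by
          rintro σ' rfl
          exact hred.exists_eq_succ_cons hτ.of_cons
        rw [dropLower_cons_self hs hsucc, dropUpper_cons_of_ge le_rfl,
          dropUpper_cons_of_lt (Nat.lt_succ_self s), ← hup]
        simp [wordIns, rowIns_cons_self, wordIns_cons_of_lt hs, ih hτ.of_cons hσ' hred]
      · have hred : IsReducedWord (τ ++ s :: σ) :=
          IsReducedWord.factor (u := [t]) (w := []) (by simpa using h)
        rw [dropLower_cons_of_gt hst, dropUpper_cons_of_ge hst.le, wordIns_cons_of_lt,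
          ih hτ.of_cons hσ hred]
        intro x hx
        rcases List.mem_cons.1 hx with rfl | hx
        · exact hst
        · exact hst.trans (hs x hx)

theorem dropUpper_sublist (τ σ : List ℕ) : (dropUpper τ σ).Sublist τ := by
  induction τ generalizing σ with
  | nil => exact List.Sublist.refl _
  | cons t τ ih =>
    cases σ with
    | nil => simp [dropUpper_nil_right]
    | cons s σ =>
      by_cases hs : s < t
      · rw [dropUpper_cons_of_lt hs]
        exact (ih σ).cons_cons t
      · rw [dropUpper_cons_of_ge (not_lt.1 hs)]
        exact (ih (s :: σ)).cons t

/-! ### Termination -/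

/-- A row may be dropped only if one of its letters is unsupported. -/
theorem CanDrop.length_dropUpper_lt {U L : List ℕ} (h : CanDrop U L) :
    (dropUpper U L).length < U.length := by
  refine (dropUpper_sublist U L).length_le.lt_of_ne fun heq => ?_
  have key : ∀ U L : List ℕ, dropUpper U L = U →
      U.length ≤ L.length ∧ ∀ (j a b : ℕ), U[j]? = some a → L[j]? = some b → b < a := by
    intro U
    induction U with
    | nil => simp
    | cons t U ih =>
      intro L hL
      cases L with
      | nil => simp [dropUpper_nil_right] at hL
      | cons s L =>
        by_cases hs : s < t
        · rw [dropUpper_cons_of_lt hs, List.cons_inj_right] at hL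
          obtain ⟨h1, h2⟩ := ih L hL
          refine ⟨by simpa using h1, fun j a b ha hb => ?_⟩
          cases j with
          | zero => simp_all
          | succ j => exact h2 j a b (by simpa using ha) (by simpa using hb)
        · rw [dropUpper_cons_of_ge (not_lt.1 hs)] at hL
          have := (dropUpper_sublist U (s :: L)).length_le
          rw [hL] at this
          simp at this
  obtain ⟨h1, h2⟩ := key U L ((dropUpper_sublist U L).eq_of_length heq)
  rcases h with h | ⟨j, a, b, ha, hb, hab⟩
  · omega
  · have := h2 j a b ha hb
    omega

theorem length_raiseRun (x : ℕ) (l : List ℕ) : (raiseRun x l).length = l.length := by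
  induction l generalizing x with
  | nil => rfl
  | cons y l ih =>
    unfold raiseRun
    split_ifs <;> simp [ih]

theorem length_hatBlock (x : ℕ) (B : List (ℕ × ℕ)) : (hatBlock x B).length = B.length := by
  unfold hatBlock
  split_ifs <;> simp [length_raiseRun]

theorem length_dropUpper_add_dropLower (τ σ : List ℕ) :
    (dropUpper τ σ).length + (dropLower τ σ).length = τ.length + σ.length := by
  induction τ generalizing σ with
  | nil => simp [dropUpper_nil_left, dropLower_nil_left]
  | cons t τ ih =>
    cases σ with
    | nil => simp [dropUpper_nil_right, dropLower_nil_right]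
    | cons s σ =>
      by_cases hs : s < t
      · have := ih σ
        rw [dropUpper_cons_of_lt hs, dropLower_cons_of_lt hs]
        simp only [List.length_cons]
        omega
      · have := ih (s :: σ)
        have e : (dropLower (t :: τ) (s :: σ)).length = (dropLower τ (s :: σ)).length + 1 := by
          simp [dropLower, dropAlign, hs, length_hatBlock]
        rw [dropUpper_cons_of_ge (not_lt.1 hs), e]
        simp only [List.length_cons] at this ⊢
        omega

/-- The sum, over all letters of a filling, of the number of rows below the letter. A step moves
at least one letter down by one row, so it decreases the weight. -/
def weight : List (List ℕ) → ℕ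
  | [] => 0
  | R :: T => T.length * R.length + weight T

theorem DropStep.weight_lt {T T' : List (List ℕ)} (h : DropStep T T') :
    weight T' < weight T := by
  obtain ⟨above, below, U, L, hc, rfl, rfl⟩ := h
  have h1 := hc.length_dropUpper_lt
  have h2 := length_dropUpper_add_dropLower U L
  induction above with
  | nil =>
    simp only [List.nil_append, weight, List.length_cons]
    nlinarith
  | cons R above ih =>
    simp only [List.cons_append, weight, List.length_append, List.length_cons] at ih ⊢
    omega

theorem acc_dropStep (T : List (List ℕ)) : Acc (fun T' T => DropStep T T') T :=
  (Subrelation.wf (fun h => DropStep.weight_lt h) (measure weight).wf).apply T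

/-! ### Final fillings -/

/-- Row `U` may lie above row `L` in an increasing Young tableau: it is not longer, and the columns
are strict. -/
def FitsAbove (U L : List ℕ) : Prop :=
  U.length ≤ L.length ∧ ∀ (j a b : ℕ), U[j]? = some a → L[j]? = some b → b < a

theorem not_canDrop_iff {U L : List ℕ} : ¬ CanDrop U L ↔ FitsAbove U L := by
  simp only [CanDrop, FitsAbove, not_or, not_lt, not_exists, not_and, not_le]

theorem FitsAbove.trans {U M L : List ℕ} (h : FitsAbove U M) (h' : FitsAbove M L) :
    FitsAbove U L := by
  refine ⟨h.1.trans h'.1, fun j a b ha hb => ?_⟩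
  have hj : j < M.length := (List.getElem?_eq_some_iff.1 ha).1.trans_le h.1
  exact (h'.2 j M[j] b (List.getElem?_eq_getElem hj) hb).trans
    (h.2 j a M[j] ha (List.getElem?_eq_getElem hj))

theorem pairwise_fitsAbove_iff {T : List (List ℕ)} :
    T.Pairwise FitsAbove ↔ ColumnsIncreasing T ∧ HasPartitionShape T := by
  unfold ColumnsIncreasing HasPartitionShape FitsAbove
  rw [List.pairwise_map, List.pairwise_and_iff, and_comm]

/-- The relation `FitsAbove` is transitive, so it suffices to look at adjacent rows. -/
theorem not_exists_dropStep_iff {T : List (List ℕ)} :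
    (¬ ∃ T', DropStep T T') ↔ T.Pairwise FitsAbove := by
  have : IsTrans (List ℕ) FitsAbove := ⟨fun _ _ _ => FitsAbove.trans⟩
  rw [← List.isChain_iff_pairwise, List.isChain_iff_forall_rel_of_append_cons_cons]
  constructor
  · intro h U L above below hT
    rw [← not_canDrop_iff]
    exact fun hc => h ⟨_, above, below, U, L, hc, hT, rfl⟩
  · rintro h ⟨_, above, below, U, L, hc, hT, -⟩
    exact not_canDrop_iff.2 (h hT) hc

/-! ### Uniqueness of the increasing Young tableau -/

/-- If `U` fits above `L`, insertion of `L` into `U` bumps all of `U`. -/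
theorem wordIns_of_fitsAbove {U L : List ℕ} (hL : L.Pairwise (· < ·)) (h : FitsAbove U L) :
    wordIns U L = (L, U) := by
  induction U generalizing L with
  | nil =>
    clear h
    induction L with
    | nil => rfl
    | cons s L ih =>
      rw [List.pairwise_cons] at hL
      simp [wordIns, rowIns_nil, wordIns_cons_of_lt hL.1, ih hL.2]
  | cons t U ih =>
    cases L with
    | nil => simpa using h.1
    | cons s L =>
      have hst : s < t := h.2 0 t s rfl rfl
      have hUL : FitsAbove U L := ⟨by simpa using h.1, fun j a b ha hb => h.2 (j + 1) a b ha hb⟩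
      rw [List.pairwise_cons] at hL
      simp [wordIns, rowIns_cons_of_lt hst, wordIns_cons_of_lt hL.1, ih hL.2 hUL]

/-- Insertion of the reading word of an increasing Young tableau into the empty row gives the
bottom row, and bumps the reading word of the other rows. -/
theorem wordIns_flatten {T : List (List ℕ)} {R : List ℕ} (hrows : RowsIncreasing (T ++ [R]))
    (hT : (T ++ [R]).Pairwise FitsAbove) : wordIns [] (T ++ [R]).flatten = (R, T.flatten) := by
  induction T using List.reverseRecOn generalizing R with
  | nil =>
    have : FitsAbove [] R := ⟨by simp, by simp⟩
    simpa using wordIns_of_fitsAbove (hrows R (by simp)) this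
  | append_singleton T M ih =>
    have h1 := ih (fun S hS => hrows S (by simp at hS ⊢; tauto)) (List.pairwise_append.1 hT).1
    have h2 : FitsAbove M R := (List.pairwise_append.1 hT).2.2 M (by simp) R (by simp)
    rw [List.flatten_append, wordIns_append, h1]
    simp [wordIns_of_fitsAbove (hrows R (by simp)) h2]

/-- A Coxeter–Knuth class of reduced words has at most one increasing Young tableau, up to empty
rows: insertion into the empty row recovers the bottom row and the class of the other rows. -/
theorem flatten_eq_of_ckEquiv {T T' : List (List ℕ)} (hrows : RowsIncreasing T)
    (hrows' : RowsIncreasing T') (hT : T.Pairwise FitsAbove) (hT' : T'.Pairwise FitsAbove)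
    (hred : IsReducedWord T.flatten) (h : CKEquiv T.flatten T'.flatten) :
    T.flatten = T'.flatten ∧ (T.length = T'.length → T = T') := by
  induction T using List.reverseRecOn generalizing T' with
  | nil =>
    have := h.length_eq
    refine ⟨(List.length_eq_zero_iff.1 this.symm).symm, fun hl => ?_⟩
    exact (List.length_eq_zero_iff.1 hl.symm).symm
  | append_singleton T R ih =>
    rcases List.eq_nil_or_concat T' with rfl | ⟨T', R', rfl⟩
    · exact ⟨List.length_eq_zero_iff.1 h.length_eq, fun hl => by simp at hl⟩
    · rw [List.concat_eq_append] at *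
      have hs := SameIns.of_ckEquiv List.Pairwise.nil h (by simpa using hred)
      unfold SameIns at hs
      rw [wordIns_flatten hrows hT, wordIns_flatten hrows' hT'] at hs
      obtain ⟨hR, hB⟩ := hs
      dsimp only at hR hB
      subst hR
      have hred' : IsReducedWord T.flatten :=
        IsReducedWord.factor (u := []) (w := R) (by simpa using hred)
      obtain ⟨h1, h2⟩ := ih (fun S hS => hrows S (by simp [hS]))
        (fun S hS => hrows' S (by simp [hS])) (List.pairwise_append.1 hT).1
        (List.pairwise_append.1 hT').1 hred' hB
      exact ⟨by simp [h1], fun hl => by rw [h2 (by simpa using hl)]⟩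

/-- The reading word of an increasing Young tableau descends at the end of each nonempty row: the
last letter of the row is at least its first letter, which exceeds the letter below. -/
theorem descentTableau_flatten {T : List (List ℕ)} (hrows : RowsIncreasing T)
    (hT : T.Pairwise FitsAbove) : descentTableau T.flatten = T.filter (· ≠ []) := by
  have hfl : T.flatten = (T.filter (· ≠ [])).flatten := by
    clear hT hrows
    induction T with
    | nil => rfl
    | cons R T ih =>
      by_cases hR : R = [] <;> simp [hR, ih]
  rw [hfl]
  refine List.splitBy_flatten (by simp) ?_ ?_
  · intro R hR
    simpa using (hrows R (List.mem_of_mem_filter hR)).isChain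
  · have hne : ∀ R ∈ T.filter (· ≠ []), R ≠ [] := fun R hR => by
      simpa using (List.mem_filter.1 hR).2
    refine List.Pairwise.isChain
      ((List.Pairwise.and_mem.1 (hT.filter (· ≠ []))).imp fun {U L} ⟨hU, hL, hUL⟩ => ?_)
    refine ⟨hne U hU, hne L hL, ?_⟩
    obtain ⟨u, U', rfl⟩ := List.exists_cons_of_ne_nil (hne U hU)
    obtain ⟨l, L', rfl⟩ := List.exists_cons_of_ne_nil (hne L hL)
    have h1 : l < u := hUL.2 0 u l rfl rfl
    have h2 : u ≤ (u :: U').getLast (by simp) := by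
      have hp := hrows _ (List.mem_of_mem_filter hU)
      rcases List.mem_cons.1 (List.getLast_mem (List.cons_ne_nil u U')) with h | h
      · exact h.ge
      · exact ((List.pairwise_cons.1 hp).1 _ h).le
    exact decide_eq_false (h1.le.trans h2).not_gt

/-! ### The procedure -/

theorem flatten_descentTableau (ρ : List ℕ) : (descentTableau ρ).flatten = ρ :=
  List.flatten_splitBy _ ρ

theorem rowsIncreasing_descentTableau (ρ : List ℕ) : RowsIncreasing (descentTableau ρ) := by
  intro R hR
  have := List.isChain_of_mem_splitBy hR
  simpa using this.pairwise

/-- A step of the procedure keeps the number of rows, strictly increasing rows, and the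
Coxeter–Knuth class of the reading word. -/
theorem DropStep.preserves {T T' : List (List ℕ)} (h : DropStep T T') (hrows : RowsIncreasing T)
    (hred : IsReducedWord T.flatten) :
    T'.length = T.length ∧ RowsIncreasing T' ∧ CKEquiv T.flatten T'.flatten := by
  obtain ⟨above, below, U, L, -, rfl, rfl⟩ := h
  have hU := hrows U (by simp)
  have hL := hrows L (by simp)
  have hUL : IsReducedWord (U ++ L) :=
    IsReducedWord.factor (u := above.flatten) (w := below.flatten) (by simpa using hred)
  have hins := wordIns_eq_drop hU hL hUL
  have hck := ckEquiv_wordIns hU hUL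
  have hrow := pairwise_wordIns hU L
  rw [hins] at hck hrow
  refine ⟨by simp, ?_, by simpa using hck.context above.flatten below.flatten⟩
  intro R hR
  simp only [List.mem_append, List.mem_cons] at hR
  rcases hR with hR | rfl | rfl | hR
  · exact hrows R (by simp [hR])
  · exact hU.sublist (dropUpper_sublist U L)
  · exact hrow
  · exact hrows R (by simp [hR])

theorem Reaches.preserves {ρ : List ℕ} (hρ : IsReducedWord ρ) {T : List (List ℕ)}
    (h : Reaches ρ T) :
    T.length = (descentTableau ρ).length ∧ RowsIncreasing T ∧ CKEquiv ρ T.flatten := by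
  induction h with
  | refl =>
    refine ⟨rfl, rowsIncreasing_descentTableau ρ, ?_⟩
    rw [flatten_descentTableau]
    exact CKEquiv.refl ρ
  | tail _ hs ih =>
    obtain ⟨h1, h2, h3⟩ := ih
    obtain ⟨h1', h2', h3'⟩ := hs.preserves h2 (h3.isReducedWord_iff.1 hρ)
    exact ⟨h1'.trans h1, h2', h3.trans h3'⟩

theorem exists_reaches_of_acc {T : List (List ℕ)} (h : Acc (fun T' T => DropStep T T') T) :
    ∃ T', Relation.ReflTransGen DropStep T T' ∧ ¬ ∃ T'', DropStep T' T'' := by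
  induction h with
  | intro T _ ih =>
    by_cases hT : ∃ T', DropStep T T'
    · obtain ⟨T', hT'⟩ := hT
      obtain ⟨T'', h1, h2⟩ := ih T' hT'
      exact ⟨T'', h1.head hT', h2⟩
    · exact ⟨T, Relation.ReflTransGen.refl, hT⟩

end DropWord

theorem mainTheorem5 (ρ : List ℕ) (hρ : DropWord.IsReducedWord ρ) :
    -- every intermediate filling is an increasing factorization of a reduced word, so that the
    -- next `drop_k` is always defined
    (∀ T, DropWord.Reaches ρ T →
      DropWord.RowsIncreasing T ∧ DropWord.IsReducedWord T.flatten) ∧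
    -- the procedure terminates, whatever choices are made
    Acc (fun T' T => DropWord.DropStep T T') (DropWord.descentTableau ρ) ∧
    -- it stops exactly at the increasing Young tableaux
    (∀ T, DropWord.Reaches ρ T →
      ((¬ ∃ T', DropWord.DropStep T T') ↔
        DropWord.IsIncreasing T ∧ DropWord.HasPartitionShape T)) ∧
    -- the final tableau, and hence its word, does not depend on the choices
    (∃! T, DropWord.Reaches ρ T ∧ DropWord.IsIncreasing T ∧ DropWord.HasPartitionShape T) ∧
    (∃! π, DropWord.IsDrop ρ π) ∧
    -- `drop(ρ)` is the unique reduced word Coxeter–Knuth equivalent to `ρ` whose descent tableau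
    -- is increasing and of partition shape
    (∀ π, DropWord.IsDrop ρ π ↔
      DropWord.IsReducedWord π ∧ DropWord.CKEquiv ρ π ∧
        DropWord.IsIncreasing (DropWord.descentTableau π) ∧
        DropWord.HasPartitionShape (DropWord.descentTableau π)) := by
  open DropWord in
  have hyoung : ∀ T, IsIncreasing T ∧ HasPartitionShape T ↔
      RowsIncreasing T ∧ T.Pairwise FitsAbove := fun T => by
    rw [pairwise_fitsAbove_iff, IsIncreasing, and_assoc]
  have hfinal : ∀ T, Reaches ρ T →
      ((¬ ∃ T', DropStep T T') ↔ IsIncreasing T ∧ HasPartitionShape T) := by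
    intro T hT
    rw [not_exists_dropStep_iff, hyoung]
    exact (and_iff_right (hT.preserves hρ).2.1).symm
  obtain ⟨T₀, hT₀, hfinal₀⟩ := exists_reaches_of_acc (acc_dropStep (descentTableau ρ))
  have hY₀ := (hfinal T₀ hT₀).1 hfinal₀
  obtain ⟨hlen₀, hrows₀, hck₀⟩ := Reaches.preserves hρ hT₀
  have hred₀ := hck₀.isReducedWord_iff.1 hρ
  have hst₀ := ((hyoung T₀).1 hY₀).2
  have huniq : ∀ T, Reaches ρ T ∧ IsIncreasing T ∧ HasPartitionShape T → T = T₀ := by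
    rintro T ⟨hT, hY⟩
    obtain ⟨hlen, hrows, hck⟩ := hT.preserves hρ
    exact ((flatten_eq_of_ckEquiv hrows₀ hrows hst₀ ((hyoung T).1 hY).2 hred₀
      (hck₀.symm.trans hck)).2 (hlen₀.trans hlen.symm)).symm
  have hdrop : ∀ π, IsDrop ρ π ↔ π = T₀.flatten := by
    refine fun π => ⟨?_, ?_⟩
    · rintro ⟨T, hT, hI, hP, rfl⟩
      rw [huniq T ⟨hT, hI, hP⟩]
    · rintro rfl
      exact ⟨T₀, hT₀, hY₀.1, hY₀.2, rfl⟩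
  refine ⟨fun T hT => ?_, acc_dropStep _, hfinal, ⟨T₀, ⟨hT₀, hY₀⟩, huniq⟩,
    ⟨T₀.flatten, (hdrop _).2 rfl, fun π hπ => (hdrop π).1 hπ⟩, fun π => ?_⟩
  · obtain ⟨-, hrows, hck⟩ := hT.preserves hρ
    exact ⟨hrows, hck.isReducedWord_iff.1 hρ⟩
  · rw [hdrop, hyoung]
    constructor
    · rintro rfl
      rw [descentTableau_flatten hrows₀ hst₀]
      exact ⟨hred₀, hck₀, fun R hR => hrows₀ R (List.mem_of_mem_filter hR), hst₀.filter _⟩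
    · rintro ⟨-, hck, hrows, hst⟩
      have h := (flatten_eq_of_ckEquiv hrows₀ hrows hst₀ hst hred₀
        (by rw [flatten_descentTableau]; exact hck₀.symm.trans hck)).1
      rw [h, flatten_descentTableau]
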